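/- **Bound for the Renewal Central Limit Theorem under second moment assumptions.** Let $Z_0, Z_1, Z_2, \ldots$ be independent, identically distributed, almost surely non-negative random variables with mean $\mu \in (0,\infty)$ and finite variance $\sigma^2$, where $\sigma \in (0,\infty)$. Let $T_n = Z_0 + \cdots + Z_{n-1}$ for $n \ge 1$, and let $X_t = \#\{n \ge 1 : T_n \le t\}$ be the associated renewal process. Let $\Phi$ denote the standard normal distribution function. Then for every integer $n \ge 1$ and every real $t > 0$, $$ \begin{aligned} \left| \mathbb P(X_t < n) - \Phi\!\left(\frac{(n\mu - t)\sqrt{\mu}}{\sigma\sqrt{t}}\right)\right| \;\le\;& \mathbf 1(t \le n\mu)\,\frac{\sqrt 2}{e\sqrt{\pi}}\,\frac{\sigma}{\sqrt t\,\mu} + \mathbf 1(t > n\mu)\,\frac{32}{e^2\sqrt{2\pi}}\,\frac{1}{\sqrt t}\left(\frac{\sigma^3}{\mu^2\sqrt t} + \frac{\sigma}{224^2\sqrt{\mu}}\right)\\ &+ 50990\left(1 + \left|\frac{t - n\mu}{\sigma\sqrt n}\right|\right)^{-2}. \end{aligned} $$ -/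

import Mathlib

open MeasureTheory ProbabilityTheory

/-- The `n`-th arrival time `T_n = Z_0 + ... + Z_{n-1}`. -/
noncomputable def arrivalTime {Ω : Type*} (Z : ℕ → Ω → ℝ) (n : ℕ) (ω : Ω) : ℝ :=
  ∑ i ∈ Finset.range n, Z i ω

/-- The renewal process `X_t = #{n ≥ 1 : T_n ≤ t}`, as an extended natural number
(it may be infinite on a null set). -/
noncomputable def renewalProcess {Ω : Type*} (Z : ℕ → Ω → ℝ) (t : ℝ) (ω : Ω) : ℕ∞ :=
  Set.encard {n : ℕ | 1 ≤ n ∧ arrivalTime Z n ω ≤ t}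

/-- The distribution function of the standard normal law. -/
noncomputable def stdNormalCDF (x : ℝ) : ℝ := cdf (gaussianReal 0 1) x

/-! Almost surely `X_t < n` means `t < T_n`. Put `x = (t - nμ)/(σ√n)`. The constant 50990 exceeds
`225 ^ 2`, so the bound is trivial for `|x| ≤ 224`. For larger `|x|` no Berry–Esseen estimate is
needed: the probability and the normal value are both near 0 (if `t > nμ`) or both near 1. Chebyshev
puts the first within `1 / x ^ 2` of that limit, and a Chernoff bound controls the Gaussian tail. -/

/-- For a nonnegative sequence the renewal process is below `n` exactly when the `n`-th arrival
happens after time `t`. -/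
theorem renewalProcess_lt_iff {Ω : Type*} (Z : ℕ → Ω → ℝ) (ω : Ω) (hZ : ∀ i, 0 ≤ Z i ω)
    {n : ℕ} (hn : 1 ≤ n) (t : ℝ) :
    renewalProcess Z t ω < (n : ℕ∞) ↔ t < arrivalTime Z n ω := by
  have hmono : Monotone fun m => arrivalTime Z m ω := fun a b hab =>
    Finset.sum_le_sum_of_subset_of_nonneg (Finset.range_mono hab) fun i _ _ => hZ i
  unfold renewalProcess
  constructor
  · intro h
    by_contra! hle
    refine absurd h (not_lt.mpr ?_)
    calc (n : ℕ∞) = Set.encard (Finset.Icc 1 n : Set ℕ) := by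
          rw [Set.encard_coe_eq_coe_finsetCard]; simp
      _ ≤ _ := Set.encard_le_encard fun m hm => by
          have hm' := Finset.mem_Icc.mp (Finset.mem_coe.mp hm)
          exact ⟨hm'.1, (hmono hm'.2).trans hle⟩
  · intro h
    calc _ ≤ Set.encard (Finset.Icc 1 (n - 1) : Set ℕ) := Set.encard_le_encard fun m hm => by
          have : m < n := by
            by_contra! hnm
            exact absurd (hm.2.trans_lt h) (not_lt.mpr (hmono hnm))
          exact Finset.mem_coe.mpr (Finset.mem_Icc.mpr ⟨hm.1, by omega⟩)
      _ < n := by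
          rw [Set.encard_coe_eq_coe_finsetCard, Nat.card_Icc]
          exact_mod_cast (by omega : n - 1 + 1 - 1 < n)

/-- Chernoff bound with the optimal parameter, equal to `x` itself. -/
theorem stdNormalCDF_le_exp {x : ℝ} (hx : x ≤ 0) : stdNormalCDF x ≤ Real.exp (-(x ^ 2 / 2)) := by
  have h := measure_le_le_exp_mul_mgf (μ := gaussianReal 0 1) (X := id) x hx
    (integrable_exp_mul_gaussianReal x)
  rw [mgf_id_gaussianReal, ← Real.exp_add] at h
  rw [stdNormalCDF, cdf_eq_real]
  refine h.trans_eq (congrArg _ ?_)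
  simp
  ring

theorem one_sub_stdNormalCDF_le_exp {x : ℝ} (hx : 0 ≤ x) :
    1 - stdNormalCDF x ≤ Real.exp (-(x ^ 2 / 2)) := by
  have h := measure_ge_le_exp_mul_mgf (μ := gaussianReal 0 1) (X := id) x hx
    (integrable_exp_mul_gaussianReal x)
  rw [mgf_id_gaussianReal, ← Real.exp_add] at h
  rw [stdNormalCDF, cdf_eq_real, ← probReal_compl_eq_one_sub measurableSet_Iic, Set.compl_Iic]
  refine (measureReal_mono (fun y hy => (Set.mem_Ioi.mp hy).le)).trans
    (h.trans_eq (congrArg _ ?_))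
  simp
  ring

theorem stdNormalCDF_nonneg (x : ℝ) : 0 ≤ stdNormalCDF x := cdf_nonneg _ x

theorem stdNormalCDF_le_one (x : ℝ) : stdNormalCDF x ≤ 1 := cdf_le_one _ x

theorem exp_neg_half_sq_le_two_div_sq {y : ℝ} (hy : 0 < y ^ 2) :
    Real.exp (-(y ^ 2 / 2)) ≤ 2 / y ^ 2 := by
  rw [Real.exp_neg, inv_le_comm₀ (Real.exp_pos _) (by positivity), inv_div]
  linarith [Real.add_one_le_exp (y ^ 2 / 2)]

/-- The quadratic term of `exp (y ^ 2 / 2)` is `y ^ 4 / 8`. This faster decay is needed when `t` is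
far above the mean. -/
theorem exp_neg_half_sq_le_eight_div_pow_four {y : ℝ} (hy : 0 < y ^ 2) :
    Real.exp (-(y ^ 2 / 2)) ≤ 8 / y ^ 4 := by
  have hy4 : 0 < y ^ 4 := by nlinarith
  rw [Real.exp_neg, inv_le_comm₀ (Real.exp_pos _) (by positivity), inv_div]
  nlinarith [Real.quadratic_le_exp_of_nonneg (x := y ^ 2 / 2) (by positivity)]

theorem one_le_gaussian_constant : 1 ≤ 32 / (Real.exp 1 ^ 2 * √(2 * Real.pi)) := by
  have h1 : Real.exp 1 < 3 := Real.exp_one_lt_d9.trans (by norm_num)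
  have h2 : √(2 * Real.pi) ≤ 3 := by
    rw [Real.sqrt_le_left (by norm_num)]
    linarith [Real.pi_lt_d2]
  have h3 : Real.exp 1 ^ 2 ≤ 9 := by nlinarith [Real.exp_pos 1]
  rw [one_le_div (by positivity)]
  nlinarith [Real.sqrt_nonneg (2 * Real.pi)]

section ArrivalTime

variable {Ω : Type*} [MeasurableSpace Ω] {P : Measure Ω} [IsProbabilityMeasure P]
  {Z : ℕ → Ω → ℝ}

/-- Chebyshev's inequality for the arrival times. -/
theorem measureReal_abs_arrivalTime_sub_le
    (hindep : iIndepFun Z P) (hident : ∀ i, IdentDistrib (Z i) (Z 0) P P)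
    (hL2 : MemLp (Z 0) 2 P) {μ σ : ℝ}
    (hmean : ∫ ω, Z 0 ω ∂P = μ) (hvar : variance (Z 0) P = σ ^ 2) (n : ℕ) {c : ℝ} (hc : 0 < c) :
    P.real {ω | c ≤ |arrivalTime Z n ω - n * μ|} ≤ n * σ ^ 2 / c ^ 2 := by
  have hL : ∀ i, MemLp (Z i) 2 P := fun i => (hident i).memLp_iff.mpr hL2
  have hsum : (∑ i ∈ Finset.range n, Z i) = arrivalTime Z n := by
    ext ω
    simp [arrivalTime]
  have hmem : MemLp (arrivalTime Z n) 2 P := hsum ▸ memLp_finsetSum' _ fun i _ => hL i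
  have hE : ∫ ω, arrivalTime Z n ω ∂P = n * μ := by
    simp only [arrivalTime]
    rw [integral_finsetSum _ fun i _ => (hL i).integrable one_le_two]
    simp [fun i => (hident i).integral_eq, hmean]
  have hV : variance (arrivalTime Z n) P = n * σ ^ 2 := by
    rw [← hsum, IndepFun.variance_sum (fun i _ => hL i)
      fun i _ j _ hij => hindep.indepFun hij]
    simp [fun i => (hident i).variance_eq, hvar]
  have h := meas_ge_le_variance_div_sq hmem hc
  rw [hE, hV] at h
  exact ENNReal.toReal_le_of_le_ofReal (by positivity) h

end ArrivalTime

/-- The normal tail is dominated by the error terms when `t` exceeds the mean `m * μ`. -/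
theorem exp_neg_half_sq_le_of_mean_lt {m μ σ t : ℝ} (hm : 1 ≤ m) (hμ : 0 < μ) (hσ : 0 < σ)
    (hlt : m * μ < t) (hx : 224 ≤ (t - m * μ) / (σ * √m)) :
    Real.exp (-(((m * μ - t) * √μ / (σ * √t)) ^ 2 / 2)) ≤
      σ ^ 3 / (μ ^ 2 * t) + 4 / ((t - m * μ) / (σ * √m)) ^ 2 := by
  have hm0 : 0 < m := by linarith
  have hmμ : 0 < m * μ := by positivity
  have ht : 0 < t := hmμ.trans hlt
  have hs : 0 < t - m * μ := by linarith
  have hy2 : ((m * μ - t) * √μ / (σ * √t)) ^ 2 = (t - m * μ) ^ 2 * μ / (σ ^ 2 * t) := by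
    rw [div_pow, mul_pow, mul_pow, Real.sq_sqrt hμ.le, Real.sq_sqrt ht.le]
    ring
  have hx2 : ((t - m * μ) / (σ * √m)) ^ 2 = (t - m * μ) ^ 2 / (σ ^ 2 * m) := by
    rw [div_pow, mul_pow, Real.sq_sqrt hm0.le]
  have hypos : 0 < ((m * μ - t) * √μ / (σ * √t)) ^ 2 := by rw [hy2]; positivity
  rcases le_total t (2 * (m * μ)) with h2 | h2
  -- With `t ≤ 2mμ` the normal argument has square at least `x ^ 2 / 2`.
  · refine (exp_neg_half_sq_le_two_div_sq hypos).trans (le_add_of_nonneg_of_le (by positivity) ?_)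
    rw [hy2, hx2, div_div_eq_mul_div, div_div_eq_mul_div,
      div_le_div_iff₀ (by positivity) (by positivity)]
    have : 0 ≤ 2 * σ ^ 2 * (t - m * μ) ^ 2 := by positivity
    nlinarith
  -- Here `t - mμ ≥ t / 2`, so the tail is at most `128σ⁴ / (t²μ²)`; `128σ ≤ t` turns this into the
  -- `σ ^ 3` term.
  · refine (exp_neg_half_sq_le_eight_div_pow_four hypos).trans
      (le_add_of_le_of_nonneg ?_ (by positivity))
    have hst : 224 * σ ≤ t := by
      rw [le_div_iff₀ (by positivity)] at hx
      have : 1 ≤ √m := Real.one_le_sqrt.mpr hm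
      nlinarith
    have hy4 : t ^ 2 * μ ^ 2 / (16 * σ ^ 4) ≤ ((m * μ - t) * √μ / (σ * √t)) ^ 4 := by
      rw [show ((m * μ - t) * √μ / (σ * √t)) ^ 4 = (((m * μ - t) * √μ / (σ * √t)) ^ 2) ^ 2 by ring,
        hy2, show t ^ 2 * μ ^ 2 / (16 * σ ^ 4) = ((t / 2) ^ 2 * μ / (σ ^ 2 * t)) ^ 2 by
          field_simp; ring]
      gcongr
      linarith
    calc 8 / ((m * μ - t) * √μ / (σ * √t)) ^ 4 ≤ 8 / (t ^ 2 * μ ^ 2 / (16 * σ ^ 4)) := by gcongr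
      _ ≤ σ ^ 3 / (μ ^ 2 * t) := by
        rw [div_div_eq_mul_div, div_le_div_iff₀ (by positivity) (by positivity)]
        have : 0 ≤ σ ^ 3 * μ ^ 2 * t := by positivity
        nlinarith

theorem theorem3p1 {Ω : Type*} [MeasurableSpace Ω] (P : Measure Ω) [IsProbabilityMeasure P]
    (Z : ℕ → Ω → ℝ) (hmeas : ∀ i, Measurable (Z i)) (hnonneg : ∀ i, ∀ᵐ ω ∂P, 0 ≤ Z i ω)
    (hindep : iIndepFun Z P) (hident : ∀ i, IdentDistrib (Z i) (Z 0) P P)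
    (hL2 : MemLp (Z 0) 2 P) (μ σ : ℝ) (hμ : 0 < μ) (hσ : 0 < σ)
    (hmean : ∫ ω, Z 0 ω ∂P = μ) (hvar : variance (Z 0) P = σ ^ 2)
    (n : ℕ) (hn : 1 ≤ n) (t : ℝ) (ht : 0 < t) :
    |P.real {ω | renewalProcess Z t ω < (n : ℕ∞)}
        - stdNormalCDF (((n : ℝ) * μ - t) * √μ / (σ * √t))|
      ≤ (if t ≤ (n : ℝ) * μ then
            √2 / (Real.exp 1 * √Real.pi) * (σ / (√t * μ)) else 0)
        + (if (n : ℝ) * μ < t then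
            32 / (Real.exp 1 ^ 2 * √(2 * Real.pi)) * (1 / √t)
              * (σ ^ 3 / (μ ^ 2 * √t) + σ / (224 ^ 2 * √μ)) else 0)
        + 50990 * (1 + |(t - (n : ℝ) * μ) / (σ * √(n : ℝ))|) ^ (-2 : ℤ) := by
  have hn1 : (1 : ℝ) ≤ n := by exact_mod_cast hn
  have hn0 : (0 : ℝ) < n := by linarith
  have hevent : P.real {ω | renewalProcess Z t ω < (n : ℕ∞)} =
      P.real {ω | t < arrivalTime Z n ω} := by
    refine measureReal_congr ?_
    filter_upwards [ae_all_iff.mpr hnonneg] with ω hω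
    exact propext (renewalProcess_lt_iff Z ω hω hn t)
  rw [hevent]
  set x := (t - (n : ℝ) * μ) / (σ * √(n : ℝ)) with hxdef
  set y := ((n : ℝ) * μ - t) * √μ / (σ * √t) with hydef
  have hA : 0 ≤ (if t ≤ (n : ℝ) * μ then
      √2 / (Real.exp 1 * √Real.pi) * (σ / (√t * μ)) else 0) := by
    split_ifs <;> positivity
  have hB : (if (n : ℝ) * μ < t then σ ^ 3 / (μ ^ 2 * t) else 0) ≤
      (if (n : ℝ) * μ < t then 32 / (Real.exp 1 ^ 2 * √(2 * Real.pi)) * (1 / √t)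
        * (σ ^ 3 / (μ ^ 2 * √t) + σ / (224 ^ 2 * √μ)) else 0) := by
    split_ifs
    · calc σ ^ 3 / (μ ^ 2 * t) = 1 * (1 / √t) * (σ ^ 3 / (μ ^ 2 * √t) + 0) := by
            nth_rewrite 1 [← Real.mul_self_sqrt ht.le]
            field_simp
            ring
        _ ≤ _ := by
            gcongr
            · exact one_le_gaussian_constant
            · positivity
    · exact le_rfl
  -- Of the first two error terms only `σ ^ 3 / (μ ^ 2 * t)`, for `t > nμ`, is kept.
  refine le_trans ?_ (add_le_add (add_le_add hA hB) le_rfl)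
  rw [zero_add, zpow_neg, zpow_ofNat]
  have hp0 : 0 ≤ P.real {ω | t < arrivalTime Z n ω} := measureReal_nonneg
  have hp1 : P.real {ω | t < arrivalTime Z n ω} ≤ 1 := measureReal_le_one
  have hq0 := stdNormalCDF_nonneg y
  have hq1 := stdNormalCDF_le_one y
  have hB0 : 0 ≤ (if (n : ℝ) * μ < t then σ ^ 3 / (μ ^ 2 * t) else 0) := by
    split_ifs <;> positivity
  rcases le_total |x| 224 with hx | hx
  · have h1 : 1 ≤ 50990 * ((1 + |x|) ^ 2)⁻¹ := by
      rw [← div_eq_mul_inv, one_le_div (by positivity)]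
      nlinarith [abs_nonneg x]
    have : |P.real {ω | t < arrivalTime Z n ω} - stdNormalCDF y| ≤ 1 :=
      abs_sub_le_iff.mpr ⟨by linarith, by linarith⟩
    linarith
  have hxpos : 0 < |x| := by linarith
  have hx2pos : 0 < x ^ 2 := by rw [← sq_abs]; positivity
  -- Ample room: `1 + |x| ≤ 2|x|`, so 16 would do in place of 50990.
  have hx2 : 4 / x ^ 2 ≤ 50990 * ((1 + |x|) ^ 2)⁻¹ := by
    rw [← div_eq_mul_inv, div_le_div_iff₀ hx2pos (by positivity), ← sq_abs x]
    nlinarith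
  have hx1 : 1 / x ^ 2 ≤ 4 / x ^ 2 := by gcongr; norm_num
  have hden : 0 < σ * √(n : ℝ) := by positivity
  have habs : |t - n * μ| = |x| * (σ * √(n : ℝ)) := by
    rw [hxdef, abs_div, abs_of_pos hden, div_mul_cancel₀ _ hden.ne']
  have hcheb : P.real {ω | |t - n * μ| ≤ |arrivalTime Z n ω - n * μ|} ≤ 1 / x ^ 2 := by
    refine (measureReal_abs_arrivalTime_sub_le hindep hident hL2 hmean hvar n
      (by rw [habs]; positivity)).trans_eq ?_
    rw [habs, mul_pow, mul_pow, sq_abs, Real.sq_sqrt hn0.le]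
    field_simp
  rcases lt_or_ge ((n : ℝ) * μ) t with hlt | hge
  · rw [if_pos hlt]
    have hs : 0 < t - n * μ := by linarith
    have hp : P.real {ω | t < arrivalTime Z n ω} ≤ 1 / x ^ 2 := by
      refine (measureReal_mono fun ω hω => ?_).trans hcheb
      have hω' : t < arrivalTime Z n ω := hω
      change |t - n * μ| ≤ |arrivalTime Z n ω - n * μ|
      rw [abs_of_pos hs]
      exact (by linarith : t - n * μ ≤ arrivalTime Z n ω - n * μ).trans (le_abs_self _)
    have hy : y ≤ 0 := div_nonpos_of_nonpos_of_nonneg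
      (mul_nonpos_of_nonpos_of_nonneg (by linarith) (Real.sqrt_nonneg _)) (by positivity)
    have hq := (stdNormalCDF_le_exp hy).trans (exp_neg_half_sq_le_of_mean_lt hn1 hμ hσ hlt
      (by rwa [← abs_of_pos (div_pos hs hden)]))
    have : 0 ≤ σ ^ 3 / (μ ^ 2 * t) := by positivity
    exact abs_sub_le_iff.mpr ⟨by linarith, by linarith⟩
  · have hmem : MeasurableSet {ω | t < arrivalTime Z n ω} :=
      measurableSet_lt measurable_const (Finset.measurable_sum _ fun i _ => hmeas i)
    have hp : 1 - P.real {ω | t < arrivalTime Z n ω} ≤ 1 / x ^ 2 := by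
      rw [← probReal_compl_eq_one_sub hmem]
      refine (measureReal_mono fun ω hω => ?_).trans hcheb
      have hω' : arrivalTime Z n ω ≤ t := not_lt.mp hω
      change |t - n * μ| ≤ |arrivalTime Z n ω - n * μ|
      rw [abs_of_nonpos (by linarith), abs_of_nonpos (by linarith)]
      linarith
    have hy : 0 ≤ y := div_nonneg
      (mul_nonneg (by linarith) (Real.sqrt_nonneg _)) (by positivity)
    -- The two squares differ by the factor `nμ / t`, which is at least 1 here.
    have hxy : x ^ 2 ≤ y ^ 2 := by
      rw [hxdef, hydef, div_pow, div_pow, mul_pow, mul_pow, mul_pow, Real.sq_sqrt hμ.le,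
        Real.sq_sqrt ht.le, Real.sq_sqrt hn0.le, div_le_div_iff₀ (by positivity) (by positivity)]
      have : 0 ≤ (t - n * μ) ^ 2 * σ ^ 2 := by positivity
      nlinarith
    have hq := (one_sub_stdNormalCDF_le_exp hy).trans
      (exp_neg_half_sq_le_two_div_sq (hx2pos.trans_le hxy))
    have hq2 : 2 / y ^ 2 ≤ 4 / x ^ 2 := by gcongr; norm_num
    exact abs_sub_le_iff.mpr ⟨by linarith, by linarith⟩
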